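/- **Theorem.** Let $\mu$ be a probability Borel measure on the unit circle $\mathbb T$ that is nontrivial (its support is infinite). Let $\Phi_n$ be its monic orthogonal polynomials, i.e. $\Phi_n$ is monic of degree $n$ and $\int_{\mathbb T}\Phi_n\overline{\Phi_m}\,d\mu=0$ for $n\neq m$, and put $$\Phi_n^*(z)=z^n\overline{\Phi_n(1/\bar z)},\qquad \alpha_n=-\overline{\Phi_{n+1}(0)},\qquad \tau_n=\frac{\Phi_n(1)}{\Phi_n^*(1)},\qquad n\ge 0,$$ $$R_n(z)=\Bigl(\prod_{j=1}^{n}\frac{1-\tau_{j-1}\alpha_{j-1}}{1-\operatorname{Re}(\tau_{j-1}\alpha_{j-1})}\Bigr)\frac{z\Phi_n(z)-\tau_n\Phi_n^*(z)}{z-1},\qquad n\ge 0,$$ so that $R_n$ is a multiple of the Christoffel–Darboux kernel $K_n(1,z)$ of $\mu$. Then there are real sequences $\{c_n\}_{n\ge1}$, $\{d_{n+1}\}_{n\ge1}$ such that, with $R_{-1}=0$ and $R_0=1$, $$R_{n+1}(z)=\bigl[(1+ic_{n+1})z+(1-ic_{n+1})\bigr]R_n(z)-4d_{n+1}zR_{n-1}(z),\qquad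 n\ge 0,\tag{1}$$ and $\{d_{n+1}\}_{n\ge1}$ is a positive chain sequence, i.e. $d_{n+1}=(1-g_n)g_{n+1}$ for $n\ge1$ with some $0\le g_1<1$ and $0<g_n<1$ for $n\ge2$. Now let $\{c_n\}_{n\ge 1}$, $\{d_{n+1}\}_{n\ge 1}$ be the real coefficients in (1), and let $\{q_{n+1}\}_{n\ge1}$ be a scaling sequence for $\{d_{n+1}\}$: $0<q_{n+1}\le1$ for all $n\ge 1$, and $\{d_{n+1}/q_{n+1}\}_{n\ge1}$ is also a positive chain sequence. For $a,b\in\mathbb R$ and $0<q<1$ let $u^{(-)}(a,b,q)<u^{(+)}(a,b,q)$ be the roots of $$(1-q)u^2-(a+b)u+ab-q=0 .$$ For $q=1$ set $u^{(+)}(a,b,1)=+\infty$ if $a+b\ge0$ and $u^{(-)}(a,b,1)=-\infty$ if $a+b\le0$; in the remaining cases $u^{(\pm)}(a,b,1)$ is the root $\frac{ab-1}{a+b}$ of the linear equation. Put $u_{n+1}^{(\pm)}=u^{(\pm)}(c_n,c_{n+1},q_{n+1})$, $n\ge1$, and $$\vartheta_1=2\operatorname{arccot}\Bigl(\sup_{n\ge1}u_{n+1}^{(+)}\Bigr),\qquad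 \vartheta_2=2\operatorname{arccot}\Bigl(\inf_{n\ge1}u_{n+1}^{(-)}\Bigr),$$ where $\operatorname{arccot}:[-\infty,+\infty]\to[0,\pi]$ is the decreasing inverse of the cotangent, with $\operatorname{arccot}(+\infty)=0$ and $\operatorname{arccot}(-\infty)=\pi$; thus $0\le\vartheta_1,\vartheta_2\le2\pi$. If $\vartheta_1<\vartheta_2$, then $$\operatorname{supp}\bigl(\mu-\mu(\{1\})\delta_1\bigr)\subseteq\mathcal A[\vartheta_1,\vartheta_2]=\{e^{i\theta}:\vartheta_1\le\theta\le\vartheta_2\},$$ where $\delta_1$ is the Dirac measure at $z=1$. -/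

import Mathlib

open MeasureTheory Polynomial
open scoped ComplexConjugate

noncomputable section

namespace CircleSupport

/-- The Borel σ-algebra of the unit circle. -/
instance instMeasurableSpaceCircle : MeasurableSpace Circle := borel Circle

instance instBorelSpaceCircle : BorelSpace Circle := ⟨rfl⟩

/-- A measure on the unit circle is nontrivial when its support is an infinite set. -/
def Nontrivial (μ : Measure Circle) : Prop := μ.support.Infinite

/-- The inner product `∫ p(z) conj(q(z)) dμ(z)` of two polynomials on the unit circle. -/
def innerProd (μ : Measure Circle) (p q : ℂ[X]) : ℂ :=
  ∫ z : Circle, p.eval (z : ℂ) * conj (q.eval (z : ℂ)) ∂μ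

/-- The monic orthogonal polynomials `Φ_n` of `μ`, obtained from `1, z, z², …` by the
Gram–Schmidt process (without normalization). -/
def monicOPUC (μ : Measure Circle) (n : ℕ) : ℂ[X] :=
  X ^ n - ∑ k : Fin n,
    C (innerProd μ (X ^ n) (monicOPUC μ k) / innerProd μ (monicOPUC μ k) (monicOPUC μ k)) * monicOPUC μ k
termination_by n
decreasing_by all_goals exact k.2

/-- The reversed polynomial `Φ_n^*(z) = z^n conj(Φ_n(1 / conj z))`: the coefficients are
conjugated and written in the opposite order. -/
def reversedOPUC (μ : Measure Circle) (n : ℕ) : ℂ[X] :=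
  ((monicOPUC μ n).map (starRingEnd ℂ)).reflect n

/-- The Verblunsky coefficients `α_n = -conj(Φ_{n+1}(0))`, `n ≥ 0`. -/
def verblunsky (μ : Measure Circle) (n : ℕ) : ℂ := -conj ((monicOPUC μ (n + 1)).eval 0)

/-- The numbers `τ_n = Φ_n(1) / Φ_n^*(1)`, `n ≥ 0`. -/
def tau (μ : Measure Circle) (n : ℕ) : ℂ := (monicOPUC μ n).eval 1 / (reversedOPUC μ n).eval 1

/-- The monic Christoffel–Darboux kernel polynomials with one variable fixed at `1`,
`P_n(z) = (z Φ_n(z) - τ_n Φ_n^*(z)) / (z - 1)`; the division is exact. -/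
def kernelPoly (μ : Measure Circle) (n : ℕ) : ℂ[X] :=
  (X * monicOPUC μ n - C (tau μ n) * reversedOPUC μ n) /ₘ (X - C 1)

/-- The normalized kernel polynomials
`R_n = (∏_{j=1}^n (1 - τ_{j-1} α_{j-1}) / (1 - Re (τ_{j-1} α_{j-1}))) P_n`. -/
def R (μ : Measure Circle) (n : ℕ) : ℂ[X] :=
  C (∏ j ∈ Finset.range n, (1 - tau μ j * verblunsky μ j) /
      ((1 - (tau μ j * verblunsky μ j).re : ℝ) : ℂ)) * kernelPoly μ n

/-- `{c_n}_{n ≥ 1}` and `{d_{n+1}}_{n ≥ 1}` are the coefficients of the recurrence relation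
`R_{n+1}(z) = [(1 + i c_{n+1}) z + (1 - i c_{n+1})] R_n(z) - 4 d_{n+1} z R_{n-1}(z)`, `n ≥ 0`,
with `R_{-1} = 0`, `R_0 = 1`. The values `c 0`, `d 0`, `d 1` play no role. -/
def IsRecurrenceCoeffs (μ : Measure Circle) (c d : ℕ → ℝ) : Prop :=
  R μ 0 = 1 ∧
  R μ 1 = (C (1 + Complex.I * c 1) * X + C (1 - Complex.I * c 1)) * R μ 0 ∧
  ∀ n : ℕ, 1 ≤ n →
    R μ (n + 1) = (C (1 + Complex.I * c (n + 1)) * X + C (1 - Complex.I * c (n + 1))) * R μ n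
      - C (4 * (d (n + 1) : ℂ)) * X * R μ (n - 1)

/-- `{d_{n+1}}_{n ≥ 1}` is a positive chain sequence: `d_{n+1} = (1 - g_n) g_{n+1}` for some
parameter sequence `{g_n}_{n ≥ 1}`. The values `d 0`, `d 1` play no role. -/
def IsPositiveChainSequence (d : ℕ → ℝ) : Prop :=
  ∃ g : ℕ → ℝ, (0 ≤ g 1 ∧ g 1 < 1) ∧ (∀ n, 2 ≤ n → 0 < g n ∧ g n < 1) ∧
    ∀ n, 1 ≤ n → d (n + 1) = (1 - g n) * g (n + 1)

/-- `{q_{n+1}}_{n ≥ 1}` is a scaling sequence for the positive chain sequence `{d_{n+1}}_{n ≥ 1}`: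
`0 < q_{n+1} ≤ 1`, and `{d_{n+1} / q_{n+1}}` is again a positive chain sequence. -/
def IsScalingSequence (q d : ℕ → ℝ) : Prop :=
  (∀ n, 1 ≤ n → 0 < q (n + 1) ∧ q (n + 1) ≤ 1) ∧ IsPositiveChainSequence (fun n => d n / q n)

/-- The discriminant of `(1 - q) u² - (a + b) u + (a b - q)`. -/
def discr (a b q : ℝ) : ℝ := (a + b) ^ 2 - 4 * (1 - q) * (a * b - q)

/-- The larger root `u⁽⁺⁾(a, b, q)` of `(1 - q) u² - (a + b) u + a b - q` for `0 ≤ q < 1`; for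
`q = 1` it is `+∞` if `a + b ≥ 0`, and the only root of the then linear polynomial otherwise. -/
def uPlus (a b q : ℝ) : EReal :=
  if q = 1 then
    if 0 ≤ a + b then ⊤ else (((a * b - 1) / (a + b) : ℝ) : EReal)
  else (((a + b + √(discr a b q)) / (2 * (1 - q)) : ℝ) : EReal)

/-- The smaller root `u⁽⁻⁾(a, b, q)` of `(1 - q) u² - (a + b) u + a b - q` for `0 ≤ q < 1`; for
`q = 1` it is `-∞` if `a + b ≤ 0`, and the only root of the then linear polynomial otherwise. -/
def uMinus (a b q : ℝ) : EReal :=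
  if q = 1 then
    if a + b ≤ 0 then ⊥ else (((a * b - 1) / (a + b) : ℝ) : EReal)
  else (((a + b - √(discr a b q)) / (2 * (1 - q)) : ℝ) : EReal)

/-- The discriminant is nonnegative, so the roots used in `uPlus` and `uMinus` are real. -/
theorem discr_nonneg (a b q : ℝ) (h0 : 0 ≤ q) (h1 : q ≤ 1) : 0 ≤ discr a b q := by
  have h : discr a b q = (1 - q) * (a - b) ^ 2 + q * (a + b) ^ 2 + 4 * (q * (1 - q)) := by
    unfold discr; ring
  have h2 : 0 ≤ 1 - q := by linarith
  rw [h]; positivity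

/-- The two numbers used in `uPlus` and `uMinus` are the roots of the quadratic polynomial. -/
theorem quadratic_factor (a b q u : ℝ) (h0 : 0 ≤ q) (h1 : q < 1) :
    (1 - q) * u ^ 2 - (a + b) * u + a * b - q =
      (1 - q) * (u - (a + b - √(discr a b q)) / (2 * (1 - q))) *
        (u - (a + b + √(discr a b q)) / (2 * (1 - q))) := by
  have h2 : 1 - q ≠ 0 := by linarith
  have hs := Real.sq_sqrt (discr_nonneg a b q h0 h1.le)
  have hd : discr a b q = (a + b) ^ 2 - 4 * (1 - q) * (a * b - q) := rfl
  generalize √(discr a b q) = s at *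
  field_simp
  linear_combination hs + hd

/-- The decreasing function `arccot : [-∞, +∞] → [0, π]` inverse to the cotangent, with
`arccot (+∞) = 0` and `arccot (-∞) = π`. -/
def arccot (x : EReal) : ℝ :=
  if x = ⊤ then 0 else if x = ⊥ then Real.pi else Real.pi / 2 - Real.arctan x.toReal

/-- `ϑ₁ = 2 arccot (sup_{n ≥ 1} u⁽⁺⁾(c_n, c_{n+1}, q_{n+1}))`. -/
def theta₁ (c q : ℕ → ℝ) : ℝ :=
  2 * arccot (⨆ (n : ℕ) (_ : 1 ≤ n), uPlus (c n) (c (n + 1)) (q (n + 1)))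

/-- `ϑ₂ = 2 arccot (inf_{n ≥ 1} u⁽⁻⁾(c_n, c_{n+1}, q_{n+1}))`. -/
def theta₂ (c q : ℕ → ℝ) : ℝ :=
  2 * arccot (⨅ (n : ℕ) (_ : 1 ≤ n), uMinus (c n) (c (n + 1)) (q (n + 1)))

/-- The closed arc `{e^{iθ} : a ≤ θ ≤ b}`. -/
def closedArc (a b : ℝ) : Set Circle := {z | ∃ θ : ℝ, a ≤ θ ∧ θ ≤ b ∧ z = Circle.exp θ}

end CircleSupport

end

/-!
Combining the Szegő recurrence with its reversed form gives (1), and the chain parameters of `d`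
are `g_{n+1} = |1 - β_n|² / (2 (1 - Re β_n))` with `β_n = τ_n α_n`.

Let `b` be real and `ζ = (b + i) / (b - i) = e^{iθ}`, so that `cot (θ / 2) = b`. For a sign
`ε = ±1`, the Christoffel transforms of the `R_n` at `ζ` are orthogonal for the sign-changing
weight `2 ε (b (1 - cos t) - sin t)`, and their squared norms have the sign of
`ε (b - i) R_{n+1}(ζ) / R_n(ζ)`. After normalization the values `R_n(ζ)` become real numbers that
satisfy a three-term recurrence with coefficients `d`. When `b` lies beyond all the roots `u⁽⁺⁾`
(or, with the other sign, all the `u⁽⁻⁾`), comparison with the chain sequence `d / q` shows that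
these numbers are positive. The weighted form is then nonnegative on polynomials, so by density of
the Laurent polynomials the weight is nonnegative `μ`-almost everywhere, which leaves no mass on the
arc where it is negative.
-/

noncomputable section

namespace CircleSupport

open scoped ComplexOrder

section Semilinear

variable {R S M : Type*} [Semiring R] [Semiring S] {σ : R →+* S} [AddCommMonoid M] [Module S M]
  (f : R[X] →ₛₗ[σ] M) {p : R[X]}

theorem apply_eq_coeff_smul_apply_X_pow {n : ℕ} (h : ∀ k ≠ n, p.coeff k = 0 ∨ f (X ^ k) = 0) :
    f p = σ (p.coeff n) • f (X ^ n) := by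
  conv_lhs => rw [p.as_sum_support_C_mul_X_pow]
  simp_rw [map_sum, ← smul_eq_C_mul, map_smulₛₗ]
  refine Finset.sum_eq_single n (fun k _ hk => ?_) fun hn => ?_
  · rcases h k hk with h | h <;> simp [h]
  · simp [notMem_support_iff.1 hn]

theorem apply_eq_zero_of_coeff_eq_zero_or (h : ∀ k, p.coeff k = 0 ∨ f (X ^ k) = 0) : f p = 0 := by
  rw [apply_eq_coeff_smul_apply_X_pow f fun k (_ : k ≠ 0) => h k]
  rcases h 0 with h | h
  · rw [h, map_zero, zero_smul]
  · rw [h, smul_zero]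

theorem apply_eq_zero_of_degree_lt {n : ℕ} (h : ∀ k < n, f (X ^ k) = 0) (hp : p.degree < n) :
    f p = 0 :=
  apply_eq_zero_of_coeff_eq_zero_or f fun k =>
    (le_or_gt n k).imp (degree_lt_iff_coeff_zero p n |>.1 hp k) (h k)

end Semilinear

theorem mul_conj_coe (z : Circle) : (z : ℂ) * conj (z : ℂ) = 1 := by
  rw [Complex.mul_conj, Circle.normSq_coe, Complex.ofReal_one]

theorem eval_reflect_map_conj {p : ℂ[X]} {n : ℕ} (hp : p.natDegree ≤ n) (z : Circle) :
    ((p.map (starRingEnd ℂ)).reflect n).eval (z : ℂ) = (z : ℂ) ^ n * conj (p.eval (z : ℂ)) := by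
  have hinv : (z : ℂ)⁻¹ = conj (z : ℂ) := by rw [← Circle.coe_inv, Circle.coe_inv_eq_conj]
  let _ : Invertible (conj (z : ℂ)) := invertibleOfNonzero (by simp)
  have hrefl := eval₂_reflect_mul_pow (RingHom.id ℂ) (conj (z : ℂ)) n (p.map (starRingEnd ℂ))
    (natDegree_map_le.trans hp)
  rw [invOf_eq_inv, ← hinv, inv_inv, ← eval, ← eval, hinv, eval_map, eval₂_at_apply] at hrefl
  rw [← hrefl, mul_left_comm, ← mul_pow, mul_conj_coe, one_pow, mul_one]

section Form

variable (μ : Measure Circle) [IsFiniteMeasure μ] (w : C(Circle, ℝ))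

theorem integrable_of_continuous {X E : Type*} [TopologicalSpace X] [CompactSpace X]
    [MeasurableSpace X] [OpensMeasurableSpace X] [NormedAddCommGroup E]
    (ν : Measure X) [IsFiniteMeasureOnCompacts ν] {f : X → E} (hf : Continuous f) :
    Integrable f ν :=
  hf.integrable_of_hasCompactSupport (HasCompactSupport.of_compactSpace f)

/-- The Hermitian form `⟨q, p⟩ = ∫ w q̄ p dμ` on polynomials, for a real weight `w` on the circle.
As usual in Mathlib, and contrary to `innerProd`, it is conjugate-linear in its *first* argument. -/
def form : ℂ[X] →ₗ⋆[ℂ] ℂ[X] →ₗ[ℂ] ℂ :=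
  LinearMap.mk₂'ₛₗ (starRingEnd ℂ) (RingHom.id ℂ)
    (fun q p => ∫ z : Circle, (w z : ℂ) * (conj (q.eval (z : ℂ)) * p.eval (z : ℂ)) ∂μ)
    (fun q q' p => by
      rw [← integral_add (integrable_of_continuous μ (by fun_prop))
        (integrable_of_continuous μ (by fun_prop))]
      simp only [eval_add, map_add, add_mul, mul_add])
    (fun a q p => by
      rw [smul_eq_mul, ← integral_const_mul]
      simp only [eval_smul, smul_eq_mul, map_mul, mul_left_comm, mul_assoc])
    (fun q p p' => by
      rw [← integral_add (integrable_of_continuous μ (by fun_prop))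
        (integrable_of_continuous μ (by fun_prop))]
      simp only [eval_add, mul_add])
    (fun a q p => by
      rw [RingHom.id_apply, smul_eq_mul, ← integral_const_mul]
      simp only [eval_smul, smul_eq_mul, mul_left_comm])

theorem form_apply (q p : ℂ[X]) :
    form μ w q p = ∫ z : Circle, (w z : ℂ) * (conj (q.eval (z : ℂ)) * p.eval (z : ℂ)) ∂μ := rfl

variable {μ w}

theorem innerProd_eq_form (p q : ℂ[X]) : innerProd μ p q = form μ 1 q p := by
  simp [innerProd, form_apply, mul_comm]

theorem form_congr {w' : C(Circle, ℝ)} {q p q' p' : ℂ[X]}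
    (h : ∀ z : Circle, (w z : ℂ) * (conj (q.eval (z : ℂ)) * p.eval (z : ℂ)) =
      w' z * (conj (q'.eval (z : ℂ)) * p'.eval (z : ℂ))) :
    form μ w q p = form μ w' q' p' := by
  simp_rw [form_apply, h]

theorem form_isSymm : (form μ w).IsSymm where
  eq q p := by
    rw [form_apply, form_apply, ← integral_conj]
    simp [mul_comm]

theorem form_X_mul_X_mul (q p : ℂ[X]) : form μ w (X * q) (X * p) = form μ w q p :=
  form_congr fun z => by
    simp only [eval_mul, eval_X, map_mul]
    linear_combination w z * conj (q.eval (z : ℂ)) * p.eval (z : ℂ) * mul_conj_coe z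

theorem form_self (p : ℂ[X]) :
    form μ w p p = ((∫ z : Circle, w z * ‖p.eval (z : ℂ)‖ ^ 2 ∂μ : ℝ) : ℂ) := by
  rw [form_apply, ← integral_complex_ofReal]
  simp [Complex.conj_mul']

theorem form_one_self_pos (hμ : Nontrivial μ) {p : ℂ[X]} (hp : p ≠ 0) : 0 < form μ 1 p p := by
  have hcont : Continuous fun z : Circle => ‖p.eval (z : ℂ)‖ ^ 2 := by fun_prop
  simp only [form_self, ContinuousMap.one_apply, one_mul]
  rw [Complex.zero_lt_real]
  refine (integral_nonneg fun z => by positivity).lt_of_ne fun h => hp ?_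
  have hzero := (integral_eq_zero_iff_of_nonneg (fun z => by positivity)
    (integrable_of_continuous μ hcont)).1 h.symm
  have hsub : μ.support ⊆ {z : Circle | p.eval (z : ℂ) = 0} :=
    Measure.support_subset_of_isClosed (isClosed_eq (by fun_prop) continuous_const) <| by
      filter_upwards [hzero] with z hz
      simpa using hz
  exact eq_zero_of_infinite_isRoot p <|
    (hμ.image Circle.coe_injective.injOn).mono (Set.image_subset_iff.2 hsub)

end Form

section OrthogonalPolynomials

variable (μ : Measure Circle)

theorem monicOPUC_zero : monicOPUC μ 0 = 1 := by
  rw [monicOPUC]; simp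

theorem isMonicOfDegree_monicOPUC (n : ℕ) : IsMonicOfDegree (monicOPUC μ n) n := by
  induction n using Nat.strong_induction_on with
  | _ n ih =>
    rcases n with _ | n
    · rw [monicOPUC_zero, isMonicOfDegree_zero_iff]
    rw [monicOPUC]
    refine (isMonicOfDegree_X_pow ℂ _).sub (Nat.lt_succ_of_le ?_)
    refine natDegree_sum_le_of_forall_le _ _ fun k _ => (natDegree_C_mul_le _ _).trans ?_
    exact (ih k k.2).natDegree_eq.trans_le (Nat.le_of_lt_succ k.2)

theorem natDegree_monicOPUC (n : ℕ) : (monicOPUC μ n).natDegree = n :=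
  (isMonicOfDegree_monicOPUC μ n).natDegree_eq

theorem coeff_monicOPUC_self (n : ℕ) : (monicOPUC μ n).coeff n = 1 := by
  simpa only [natDegree_monicOPUC] using (isMonicOfDegree_monicOPUC μ n).monic.coeff_natDegree

theorem coeff_monicOPUC_of_lt {n k : ℕ} (h : n < k) : (monicOPUC μ n).coeff k = 0 :=
  coeff_eq_zero_of_natDegree_lt (by rwa [natDegree_monicOPUC])

theorem coeff_zero_reversedOPUC (n : ℕ) : (reversedOPUC μ n).coeff 0 = 1 := by
  rw [reversedOPUC, coeff_reflect, revAt_le n.zero_le, coeff_map, Nat.sub_zero,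
    coeff_monicOPUC_self, map_one]

theorem natDegree_reversedOPUC_le (n : ℕ) : (reversedOPUC μ n).natDegree ≤ n :=
  natDegree_reflect_le.trans <| max_le le_rfl <|
    natDegree_map_le.trans (natDegree_monicOPUC μ n).le

theorem eval_reversedOPUC (n : ℕ) (z : Circle) :
    (reversedOPUC μ n).eval (z : ℂ) = (z : ℂ) ^ n * conj ((monicOPUC μ n).eval (z : ℂ)) :=
  eval_reflect_map_conj (natDegree_monicOPUC μ n).le z

theorem eval_one_reversedOPUC (n : ℕ) :
    (reversedOPUC μ n).eval 1 = conj ((monicOPUC μ n).eval 1) := by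
  simpa using eval_reversedOPUC μ n 1

variable {μ} [IsFiniteMeasure μ]

theorem form_monicOPUC_monicOPUC_of_lt (hμ : Nontrivial μ) {m n : ℕ} (h : m < n) :
    form μ 1 (monicOPUC μ m) (monicOPUC μ n) = 0 := by
  induction n using Nat.strong_induction_on generalizing m with
  | _ n ih =>
    have hm : form μ 1 (monicOPUC μ m) (monicOPUC μ m) ≠ 0 :=
      (form_one_self_pos hμ (isMonicOfDegree_monicOPUC μ m).ne_zero).ne'
    nth_rw 2 [monicOPUC]
    simp only [map_sub, map_sum, ← smul_eq_C_mul, map_smul, smul_eq_mul, innerProd_eq_form]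
    rw [Finset.sum_eq_single ⟨m, h⟩, div_mul_cancel₀ _ hm, sub_self]
    · rintro k - hk
      rcases lt_or_gt_of_ne (Fin.val_ne_of_ne hk) with hlt | hlt
      · rw [form_isSymm.isRefl.eq_zero (ih m h hlt), mul_zero]
      · rw [ih k k.2 hlt, mul_zero]
    · simp

theorem form_X_pow_monicOPUC_of_lt (hμ : Nontrivial μ) {k n : ℕ} (h : k < n) :
    form μ 1 (X ^ k) (monicOPUC μ n) = 0 := by
  obtain ⟨a, ha⟩ : ∃ a : Fin k → ℂ, X ^ k = monicOPUC μ k + ∑ j, a j • monicOPUC μ j :=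
    ⟨_, by rw [monicOPUC]; simp only [smul_eq_C_mul]; exact (sub_add_cancel _ _).symm⟩
  rw [ha, map_add, map_sum, LinearMap.add_apply, LinearMap.sum_apply,
    form_monicOPUC_monicOPUC_of_lt hμ h, zero_add]
  refine Finset.sum_eq_zero fun j _ => ?_
  rw [map_smulₛₗ, LinearMap.smul_apply, form_monicOPUC_monicOPUC_of_lt hμ (j.2.trans h), smul_zero]

theorem form_X_pow_monicOPUC_self (hμ : Nontrivial μ) (n : ℕ) :
    form μ 1 (X ^ n) (monicOPUC μ n) = form μ 1 (monicOPUC μ n) (monicOPUC μ n) := by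
  have h := apply_eq_coeff_smul_apply_X_pow ((form μ 1).flip (monicOPUC μ n)) (p := monicOPUC μ n)
    (n := n) fun k hk => hk.lt_or_gt.symm.imp (coeff_monicOPUC_of_lt μ)
      (form_X_pow_monicOPUC_of_lt hμ)
  simpa [coeff_monicOPUC_self] using h.symm

theorem form_X_pow_reversedOPUC {w : C(Circle, ℝ)} {n i j k : ℕ} (h : n + i = k + j) :
    form μ w (X ^ k) (reversedOPUC μ n) = form μ w (X ^ i * monicOPUC μ n) (X ^ j) :=
  form_congr fun z => by
    have hpow (m : ℕ) : (z : ℂ) ^ m * conj (z : ℂ) ^ m = 1 := by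
      rw [← mul_pow, mul_conj_coe, one_pow]
    have hexp : (z : ℂ) ^ n * z ^ i = z ^ k * z ^ j := by rw [← pow_add, ← pow_add, h]
    simp only [eval_mul, eval_pow, eval_X, map_mul, map_pow, eval_reversedOPUC]
    linear_combination w z * conj ((monicOPUC μ n).eval (z : ℂ)) *
      (conj (z : ℂ) ^ k * conj (z : ℂ) ^ i * hexp - conj (z : ℂ) ^ k * z ^ n * hpow i +
        conj (z : ℂ) ^ i * z ^ j * hpow k)

theorem form_X_pow_succ_reversedOPUC_of_lt (hμ : Nontrivial μ) {k n : ℕ} (h : k < n) :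
    form μ 1 (X ^ (k + 1)) (reversedOPUC μ n) = 0 := by
  rw [form_X_pow_reversedOPUC (i := 0) (j := n - (k + 1)) (by lia), pow_zero, one_mul]
  exact form_isSymm.isRefl.eq_zero (form_X_pow_monicOPUC_of_lt hμ (by lia))

theorem monicOPUC_succ (hμ : Nontrivial μ) (n : ℕ) :
    monicOPUC μ (n + 1) = X * monicOPUC μ n - C (conj (verblunsky μ n)) * reversedOPUC μ n := by
  set D := monicOPUC μ (n + 1) - X * monicOPUC μ n + C (conj (verblunsky μ n)) * reversedOPUC μ n
    with hD
  suffices h : D = 0 by linear_combination h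
  by_contra h0
  refine (form_one_self_pos hμ h0).ne'
    (apply_eq_zero_of_coeff_eq_zero_or ((form μ 1).flip D) fun k => ?_)
  rcases k with _ | k
  · left
    rw [hD, coeff_add, coeff_sub, coeff_C_mul, mul_coeff_zero, coeff_X_zero,
      coeff_zero_reversedOPUC, verblunsky, coeff_zero_eq_eval_zero, map_neg, Complex.conj_conj]
    ring
  rcases lt_or_ge k n with hk | hk
  · right
    have hX : form μ 1 (X ^ (k + 1)) (X * monicOPUC μ n) = 0 := by
      rw [pow_succ', form_X_mul_X_mul, form_X_pow_monicOPUC_of_lt hμ hk]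
    rw [LinearMap.flip_apply, hD, map_add, map_sub, ← smul_eq_C_mul, map_smul, hX,
      form_X_pow_monicOPUC_of_lt hμ (Nat.succ_lt_succ hk),
      form_X_pow_succ_reversedOPUC_of_lt hμ hk, smul_zero, sub_zero, add_zero]
  · left
    have hcoeff : (monicOPUC μ (n + 1)).coeff (k + 1) = (monicOPUC μ n).coeff k := by
      rcases hk.eq_or_lt with rfl | hk
      · rw [coeff_monicOPUC_self, coeff_monicOPUC_self]
      · rw [coeff_monicOPUC_of_lt μ hk, coeff_monicOPUC_of_lt μ (Nat.succ_lt_succ hk)]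
    rw [hD, coeff_add, coeff_sub, coeff_X_mul, coeff_C_mul, hcoeff,
      coeff_eq_zero_of_natDegree_lt ((natDegree_reversedOPUC_le μ n).trans_lt
        (Nat.lt_succ_of_le hk)), sub_self, mul_zero, add_zero]

theorem reversedOPUC_succ (hμ : Nontrivial μ) (n : ℕ) :
    reversedOPUC μ (n + 1) = reversedOPUC μ n - C (verblunsky μ n) * (X * monicOPUC μ n) := by
  have hsupp : ((fun z : Circle => (z : ℂ)) '' μ.support).Infinite :=
    hμ.image Circle.coe_injective.injOn
  refine eq_of_infinite_eval_eq _ _ (hsupp.mono ?_)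
  rintro _ ⟨z, -, rfl⟩
  have hpow : (z : ℂ) ^ n * conj (z : ℂ) ^ n = 1 := by rw [← mul_pow, mul_conj_coe, one_pow]
  simp only [Set.mem_ofPred_eq, eval_sub, eval_mul, eval_C, eval_X, eval_reversedOPUC,
    monicOPUC_succ hμ n, map_sub, map_mul, map_pow, Complex.conj_conj]
  linear_combination (z : ℂ) ^ n * conj ((monicOPUC μ n).eval (z : ℂ)) * mul_conj_coe z -
    z * (monicOPUC μ n).eval (z : ℂ) * verblunsky μ n * hpow

theorem form_X_mul_monicOPUC_one (hμ : Nontrivial μ) (n : ℕ) :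
    form μ 1 (X * monicOPUC μ n) 1 =
      verblunsky μ n * form μ 1 (monicOPUC μ n) (monicOPUC μ n) := by
  have hX : X * monicOPUC μ n =
      monicOPUC μ (n + 1) + conj (verblunsky μ n) • reversedOPUC μ n := by
    rw [monicOPUC_succ hμ, smul_eq_C_mul]; ring
  have horth : form μ 1 1 (monicOPUC μ (n + 1)) = 0 := by
    simpa using form_X_pow_monicOPUC_of_lt hμ n.succ_pos
  have hrev : form μ 1 1 (reversedOPUC μ n) = form μ 1 (monicOPUC μ n) (X ^ n) := by
    simpa using form_X_pow_reversedOPUC (μ := μ) (w := 1) (add_comm n 0)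
  rw [← form_isSymm.eq, hX, map_add, map_smul, horth, hrev, zero_add, smul_eq_mul, map_mul,
    Complex.conj_conj, form_isSymm.eq, form_X_pow_monicOPUC_self hμ]

theorem form_monicOPUC_succ_self (hμ : Nontrivial μ) (n : ℕ) :
    form μ 1 (monicOPUC μ (n + 1)) (monicOPUC μ (n + 1)) =
      ((1 - ‖verblunsky μ n‖ ^ 2 : ℝ) : ℂ) * form μ 1 (monicOPUC μ n) (monicOPUC μ n) := by
  rw [← form_X_pow_monicOPUC_self hμ (n + 1), monicOPUC_succ hμ, ← smul_eq_C_mul, map_sub,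
    map_smul, pow_succ', form_X_mul_X_mul, form_X_pow_monicOPUC_self hμ, ← pow_succ',
    form_X_pow_reversedOPUC (i := 1) (j := 0) rfl, pow_one, pow_zero, form_X_mul_monicOPUC_one hμ]
  push_cast
  rw [← Complex.conj_mul', smul_eq_mul]
  ring

theorem norm_verblunsky_lt_one (hμ : Nontrivial μ) (n : ℕ) : ‖verblunsky μ n‖ < 1 := by
  have hn := form_one_self_pos hμ (isMonicOfDegree_monicOPUC μ n).ne_zero
  have hsucc := form_one_self_pos hμ (isMonicOfDegree_monicOPUC μ (n + 1)).ne_zero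
  rw [form_monicOPUC_succ_self hμ, mul_pos_iff_of_pos_right hn, Complex.zero_lt_real] at hsucc
  nlinarith [norm_nonneg (verblunsky μ n)]

theorem eval_one_monicOPUC_ne_zero (hμ : Nontrivial μ) (n : ℕ) : (monicOPUC μ n).eval 1 ≠ 0 := by
  induction n with
  | zero => simp [monicOPUC_zero]
  | succ n ih =>
    intro h
    rw [monicOPUC_succ hμ, eval_sub, eval_mul, eval_mul, eval_C, eval_X, one_mul,
      eval_one_reversedOPUC, sub_eq_zero] at h
    have hnorm := congrArg norm h
    rw [norm_mul, Complex.norm_conj, Complex.norm_conj, eq_comm,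
      mul_eq_right₀ (norm_ne_zero_iff.2 ih)] at hnorm
    exact (norm_verblunsky_lt_one hμ n).ne hnorm

theorem eval_one_reversedOPUC_ne_zero (hμ : Nontrivial μ) (n : ℕ) :
    (reversedOPUC μ n).eval 1 ≠ 0 := by
  rw [eval_one_reversedOPUC]
  exact (_root_.map_ne_zero (starRingEnd ℂ)).2 (eval_one_monicOPUC_ne_zero hμ n)

end OrthogonalPolynomials

section KernelPolynomials

variable {μ : Measure Circle} [IsFiniteMeasure μ]

variable (μ) in
/-- The modified Verblunsky coefficients `β_n = τ_n α_n`, in terms of which the coefficients of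
the recurrence relation for `R` are expressed. -/
def modVerblunsky (n : ℕ) : ℂ := tau μ n * verblunsky μ n

theorem tau_mul_conj (hμ : Nontrivial μ) (n : ℕ) : tau μ n * conj (tau μ n) = 1 := by
  have h := eval_one_monicOPUC_ne_zero hμ n
  have hconj := (_root_.map_ne_zero (starRingEnd ℂ)).2 h
  rw [tau, eval_one_reversedOPUC, map_div₀, Complex.conj_conj]
  field_simp

theorem norm_modVerblunsky_lt_one (hμ : Nontrivial μ) (n : ℕ) : ‖modVerblunsky μ n‖ < 1 := by
  have hτ : ‖tau μ n‖ = 1 := by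
    have h := tau_mul_conj hμ n
    rw [Complex.mul_conj'] at h
    exact (pow_eq_one_iff_of_nonneg (norm_nonneg _) two_ne_zero).1 (by exact_mod_cast h)
  rw [modVerblunsky, norm_mul, hτ, one_mul]
  exact norm_verblunsky_lt_one hμ n

theorem one_sub_re_modVerblunsky_pos (hμ : Nontrivial μ) (n : ℕ) :
    0 < 1 - (modVerblunsky μ n).re :=
  sub_pos.2 ((Complex.re_le_norm _).trans_lt (norm_modVerblunsky_lt_one hμ n))

theorem one_sub_modVerblunsky_ne_zero (hμ : Nontrivial μ) (n : ℕ) : 1 - modVerblunsky μ n ≠ 0 :=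
  fun h => (one_sub_re_modVerblunsky_pos hμ n).ne' (congrArg Complex.re h)

theorem tau_mul_conj_modVerblunsky (hμ : Nontrivial μ) (n : ℕ) :
    tau μ n * conj (modVerblunsky μ n) = conj (verblunsky μ n) := by
  rw [modVerblunsky, map_mul, ← mul_assoc, tau_mul_conj hμ, one_mul]

theorem tau_succ_mul_one_sub (hμ : Nontrivial μ) (n : ℕ) :
    tau μ (n + 1) * (1 - modVerblunsky μ n) = tau μ n * (1 - conj (modVerblunsky μ n)) := by
  have heval (m : ℕ) : (monicOPUC μ m).eval 1 = tau μ m * (reversedOPUC μ m).eval 1 :=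
    (div_mul_cancel₀ _ (eval_one_reversedOPUC_ne_zero hμ m)).symm
  have hΦ := congrArg (eval 1) (monicOPUC_succ hμ n)
  have hrev := congrArg (eval 1) (reversedOPUC_succ hμ n)
  simp only [eval_sub, eval_mul, eval_C, eval_X, one_mul] at hΦ hrev
  rw [heval, hrev, heval n] at hΦ
  refine mul_right_cancel₀ (eval_one_reversedOPUC_ne_zero hμ n) ?_
  rw [mul_one_sub (tau μ n), tau_mul_conj_modVerblunsky hμ, modVerblunsky]
  linear_combination hΦ

theorem X_sub_one_mul_kernelPoly (hμ : Nontrivial μ) (n : ℕ) :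
    (X - C 1) * kernelPoly μ n = X * monicOPUC μ n - C (tau μ n) * reversedOPUC μ n := by
  rw [kernelPoly, mul_divByMonic_eq_iff_isRoot, IsRoot, eval_sub, eval_mul, eval_mul, eval_X,
    eval_C, tau, div_mul_cancel₀ _ (eval_one_reversedOPUC_ne_zero hμ n), one_mul, sub_self]

theorem isMonicOfDegree_kernelPoly (hμ : Nontrivial μ) (n : ℕ) :
    IsMonicOfDegree (kernelPoly μ n) n := by
  refine (isMonicOfDegree_X_sub_one (1 : ℂ)).of_mul_left ?_
  rw [X_sub_one_mul_kernelPoly hμ]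
  refine ((isMonicOfDegree_X ℂ).mul (isMonicOfDegree_monicOPUC μ n)).sub ?_
  have h := (natDegree_C_mul_le (tau μ n) (reversedOPUC μ n)).trans (natDegree_reversedOPUC_le μ n)
  lia

theorem one_sub_mul_tau_succ_mul_reversedOPUC_succ (hμ : Nontrivial μ) (n : ℕ) :
    C (1 - modVerblunsky μ n) * (C (tau μ (n + 1)) * reversedOPUC μ (n + 1)) =
      C (1 - conj (modVerblunsky μ n)) *
        (C (tau μ n) * reversedOPUC μ n - C (modVerblunsky μ n) * (X * monicOPUC μ n)) := by
  have hτ := congrArg C (tau_succ_mul_one_sub hμ n)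
  rw [reversedOPUC_succ hμ, modVerblunsky]
  rw [modVerblunsky] at hτ
  simp only [map_mul, map_sub, map_one] at hτ ⊢
  linear_combination (reversedOPUC μ n - C (verblunsky μ n) * X * monicOPUC μ n) * hτ

theorem one_sub_mul_X_mul_monicOPUC_succ_sub (hμ : Nontrivial μ) (n : ℕ) :
    C (1 - modVerblunsky μ n) *
        (X * monicOPUC μ (n + 1) - C (tau μ (n + 1)) * reversedOPUC μ (n + 1)) =
      (C (1 - modVerblunsky μ n) * X + C (1 - conj (modVerblunsky μ n))) *
        (X * monicOPUC μ n - C (tau μ n) * reversedOPUC μ n) -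
      C ((1 - modVerblunsky μ n) * (1 - conj (modVerblunsky μ n))) * X *
        (monicOPUC μ n - C (tau μ n) * reversedOPUC μ n) := by
  rw [mul_sub, one_sub_mul_tau_succ_mul_reversedOPUC_succ hμ, monicOPUC_succ hμ,
    ← tau_mul_conj_modVerblunsky hμ]
  simp only [map_mul, map_sub, map_one]
  ring

theorem one_sub_mul_monicOPUC_succ_sub (hμ : Nontrivial μ) (n : ℕ) :
    C (1 - modVerblunsky μ n) *
        (monicOPUC μ (n + 1) - C (tau μ (n + 1)) * reversedOPUC μ (n + 1)) =
      C (1 - modVerblunsky μ n * conj (modVerblunsky μ n)) *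
        (X * monicOPUC μ n - C (tau μ n) * reversedOPUC μ n) := by
  rw [mul_sub, one_sub_mul_tau_succ_mul_reversedOPUC_succ hμ, monicOPUC_succ hμ,
    ← tau_mul_conj_modVerblunsky hμ]
  simp only [map_mul, map_sub, map_one]
  ring

variable (μ) in
/-- The constant `∏_{j ≤ n} (1 - β_{j-1}) / (1 - Re β_{j-1})` by which the monic kernel polynomial
is multiplied in the definition of `R`. -/
def scale (n : ℕ) : ℂ :=
  ∏ j ∈ Finset.range n, (1 - modVerblunsky μ j) / ((1 - (modVerblunsky μ j).re : ℝ) : ℂ)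

variable (μ) in
/-- The coefficient `c_{n+1} = -Im β_n / (1 - Re β_n)` of the recurrence relation for `R`. -/
def recCoeff (n : ℕ) : ℝ := -(modVerblunsky μ n).im / (1 - (modVerblunsky μ n).re)

variable (μ) in
/-- The parameter `g_{n+1} = |1 - β_n|² / (2 (1 - Re β_n))` of the chain sequence `{d_{n+1}}`. -/
def chainParam (n : ℕ) : ℝ := ‖1 - modVerblunsky μ n‖ ^ 2 / (2 * (1 - (modVerblunsky μ n).re))

omit [IsFiniteMeasure μ] in
theorem scale_succ (n : ℕ) : scale μ (n + 1) =
    scale μ n * ((1 - modVerblunsky μ n) / ((1 - (modVerblunsky μ n).re : ℝ) : ℂ)) :=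
  Finset.prod_range_succ _ n

theorem scale_ne_zero (hμ : Nontrivial μ) (n : ℕ) : scale μ n ≠ 0 :=
  Finset.prod_ne_zero_iff.2 fun j _ => div_ne_zero (one_sub_modVerblunsky_ne_zero hμ j)
    (Complex.ofReal_ne_zero.2 (one_sub_re_modVerblunsky_pos hμ j).ne')

theorem X_sub_one_mul_R (hμ : Nontrivial μ) (n : ℕ) : (X - C 1) * R μ n =
    C (scale μ n) * (X * monicOPUC μ n - C (tau μ n) * reversedOPUC μ n) := by
  rw [← X_sub_one_mul_kernelPoly hμ, mul_left_comm]
  rfl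

theorem one_add_I_mul_recCoeff (hμ : Nontrivial μ) (n : ℕ) :
    1 + Complex.I * recCoeff μ n =
      (1 - modVerblunsky μ n) / ((1 - (modVerblunsky μ n).re : ℝ) : ℂ) := by
  have hre := Complex.ofReal_ne_zero.2 (one_sub_re_modVerblunsky_pos hμ n).ne'
  rw [recCoeff, eq_div_iff hre, Complex.ofReal_div, add_mul, mul_assoc, div_mul_cancel₀ _ hre]
  apply Complex.ext <;> simp

theorem one_sub_I_mul_recCoeff (hμ : Nontrivial μ) (n : ℕ) :
    1 - Complex.I * recCoeff μ n =
      (1 - conj (modVerblunsky μ n)) / ((1 - (modVerblunsky μ n).re : ℝ) : ℂ) := by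
  simpa [sub_eq_add_neg] using congrArg conj (one_add_I_mul_recCoeff hμ n)

omit [IsFiniteMeasure μ] in
theorem two_mul_chainParam (n : ℕ) : 2 * (chainParam μ n : ℂ) =
    (1 - modVerblunsky μ n) * (1 - conj (modVerblunsky μ n)) /
      ((1 - (modVerblunsky μ n).re : ℝ) : ℂ) := by
  have hconj : 1 - conj (modVerblunsky μ n) = conj (1 - modVerblunsky μ n) := by
    rw [map_sub, map_one]
  rw [hconj, Complex.mul_conj', chainParam]
  push_cast
  rw [mul_div_assoc', mul_div_mul_left _ _ two_ne_zero]

theorem one_sub_chainParam (hμ : Nontrivial μ) (n : ℕ) : 1 - chainParam μ n =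
    (1 - ‖modVerblunsky μ n‖ ^ 2) / (2 * (1 - (modVerblunsky μ n).re)) := by
  have hre := one_sub_re_modVerblunsky_pos hμ n
  rw [chainParam, eq_div_iff (by positivity), sub_mul, div_mul_cancel₀ _ (by positivity),
    Complex.sq_norm, Complex.sq_norm, Complex.normSq_apply, Complex.normSq_apply]
  simp only [Complex.sub_re, Complex.sub_im, Complex.one_re, Complex.one_im]
  ring

theorem two_mul_one_sub_chainParam (hμ : Nontrivial μ) (n : ℕ) :
    2 * ((1 - chainParam μ n : ℝ) : ℂ) =
      (1 - modVerblunsky μ n * conj (modVerblunsky μ n)) /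
        ((1 - (modVerblunsky μ n).re : ℝ) : ℂ) := by
  rw [Complex.mul_conj', one_sub_chainParam hμ]
  push_cast
  rw [mul_div_assoc', mul_div_mul_left _ _ two_ne_zero]

theorem chainParam_mem_Ioo (hμ : Nontrivial μ) (n : ℕ) : chainParam μ n ∈ Set.Ioo 0 1 := by
  have hre := one_sub_re_modVerblunsky_pos hμ n
  have hone := norm_pos_iff.2 (one_sub_modVerblunsky_ne_zero hμ n)
  have hβ : 0 < 1 - ‖modVerblunsky μ n‖ ^ 2 :=
    sub_pos.2 (pow_lt_one₀ (norm_nonneg _) (norm_modVerblunsky_lt_one hμ n) two_ne_zero)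
  have hsub : 0 < 1 - chainParam μ n := by rw [one_sub_chainParam hμ]; positivity
  exact ⟨by rw [chainParam]; positivity, sub_pos.1 hsub⟩

variable (μ) in
/-- The polynomials `Q_n = (∏_{j ≤ n} (1 - β_{j-1}) / (1 - Re β_{j-1})) (Φ_n - τ_n Φ_n^*)`, which
together with `(z - 1) R_n` satisfy a first-order system of recurrence relations. -/
def companion (n : ℕ) : ℂ[X] :=
  C (scale μ n) * (monicOPUC μ n - C (tau μ n) * reversedOPUC μ n)

theorem X_sub_one_mul_R_succ (hμ : Nontrivial μ) (n : ℕ) :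
    (X - C 1) * R μ (n + 1) =
      (C (1 + Complex.I * recCoeff μ n) * X + C (1 - Complex.I * recCoeff μ n)) *
        ((X - C 1) * R μ n) - C (2 * (chainParam μ n : ℂ)) * X * companion μ n := by
  have h := one_sub_mul_X_mul_monicOPUC_succ_sub hμ n
  rw [X_sub_one_mul_R hμ, X_sub_one_mul_R hμ, companion, scale_succ, one_add_I_mul_recCoeff hμ,
    one_sub_I_mul_recCoeff hμ, two_mul_chainParam]
  simp only [div_eq_mul_inv, C_mul] at h ⊢
  linear_combination C (scale μ n) * C (((1 - (modVerblunsky μ n).re : ℝ) : ℂ)⁻¹) * h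

theorem companion_succ (hμ : Nontrivial μ) (n : ℕ) :
    companion μ (n + 1) = C (2 * ((1 - chainParam μ n : ℝ) : ℂ)) * ((X - C 1) * R μ n) := by
  have h := one_sub_mul_monicOPUC_succ_sub hμ n
  rw [X_sub_one_mul_R hμ, companion, scale_succ, two_mul_one_sub_chainParam hμ]
  simp only [div_eq_mul_inv, C_mul] at h ⊢
  linear_combination C (scale μ n) * C (((1 - (modVerblunsky μ n).re : ℝ) : ℂ)⁻¹) * h

omit [IsFiniteMeasure μ] in
theorem reversedOPUC_zero : reversedOPUC μ 0 = 1 := by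
  simp [reversedOPUC, monicOPUC_zero]

theorem R_zero (hμ : Nontrivial μ) : R μ 0 = 1 := by
  refine mul_left_cancel₀ (X_sub_C_ne_zero (1 : ℂ)) ?_
  rw [X_sub_one_mul_R hμ]
  simp [scale, tau, monicOPUC_zero, reversedOPUC_zero]

omit [IsFiniteMeasure μ] in
theorem companion_zero : companion μ 0 = 0 := by
  simp [companion, tau, monicOPUC_zero, reversedOPUC_zero]

theorem isRecurrenceCoeffs_recCoeff (hμ : Nontrivial μ) :
    IsRecurrenceCoeffs μ (fun n => recCoeff μ (n - 1))
      (fun n => (1 - chainParam μ (n - 2)) * chainParam μ (n - 1)) := by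
  refine ⟨R_zero hμ, mul_left_cancel₀ (X_sub_C_ne_zero (1 : ℂ)) ?_, fun n hn =>
    mul_left_cancel₀ (X_sub_C_ne_zero (1 : ℂ)) ?_⟩
  · rw [X_sub_one_mul_R_succ hμ, companion_zero]
    ring
  · obtain ⟨m, rfl⟩ := Nat.exists_eq_add_of_le' hn
    rw [X_sub_one_mul_R_succ hμ, companion_succ hμ]
    push_cast
    simp only [C_mul, map_ofNat]
    ring

theorem isPositiveChainSequence_chainParam (hμ : Nontrivial μ) :
    IsPositiveChainSequence fun n => (1 - chainParam μ (n - 2)) * chainParam μ (n - 1) :=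
  ⟨fun n => chainParam μ (n - 1), Set.Ioo_subset_Ico_self (chainParam_mem_Ioo hμ _),
    fun _ _ => chainParam_mem_Ioo hμ _, fun _ _ => rfl⟩

theorem natDegree_R_le (hμ : Nontrivial μ) (n : ℕ) : (R μ n).natDegree ≤ n :=
  (natDegree_C_mul_le _ _).trans (isMonicOfDegree_kernelPoly hμ n).natDegree_eq.le

theorem coeff_R_self (hμ : Nontrivial μ) (n : ℕ) : (R μ n).coeff n = scale μ n := by
  have hK := (isMonicOfDegree_kernelPoly hμ n).monic.coeff_natDegree
  rw [(isMonicOfDegree_kernelPoly hμ n).natDegree_eq] at hK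
  rw [R, coeff_C_mul, hK, mul_one]
  rfl

theorem form_X_pow_succ_X_sub_one_mul_R_of_lt (hμ : Nontrivial μ) {k n : ℕ} (h : k < n) :
    form μ 1 (X ^ (k + 1)) ((X - C 1) * R μ n) = 0 := by
  rw [X_sub_one_mul_R hμ, ← smul_eq_C_mul, ← smul_eq_C_mul, map_smul, map_sub, map_smul,
    form_X_pow_succ_reversedOPUC_of_lt hμ h, pow_succ', form_X_mul_X_mul,
    form_X_pow_monicOPUC_of_lt hμ h, smul_zero, sub_zero, smul_zero]

theorem form_X_pow_succ_X_sub_one_mul_R_self (hμ : Nontrivial μ) (n : ℕ) :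
    form μ 1 (X ^ (n + 1)) ((X - C 1) * R μ n) =
      scale μ (n + 1) * (((1 - (modVerblunsky μ n).re : ℝ) : ℂ) *
        form μ 1 (monicOPUC μ n) (monicOPUC μ n)) := by
  have hre := Complex.ofReal_ne_zero.2 (one_sub_re_modVerblunsky_pos hμ n).ne'
  rw [X_sub_one_mul_R hμ, ← smul_eq_C_mul, ← smul_eq_C_mul, map_smul, map_sub, map_smul,
    form_X_pow_reversedOPUC (i := 1) (j := 0) rfl, pow_succ', form_X_mul_X_mul, pow_one, pow_zero,
    form_X_pow_monicOPUC_self hμ, form_X_mul_monicOPUC_one hμ, scale_succ, ← mul_assoc,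
    mul_assoc (scale μ n), div_mul_cancel₀ _ hre, modVerblunsky, smul_eq_mul, smul_eq_mul]
  ring

end KernelPolynomials

section ChristoffelTransform

theorem apply_self_nonneg_of_basis {𝕜 M ι : Type*} [RCLike 𝕜] [AddCommGroup M] [Module 𝕜 M]
    (b : Module.Basis ι 𝕜 M) {B : M →ₗ⋆[𝕜] M →ₗ[𝕜] 𝕜} (hortho : B.IsOrthoᵢ b)
    (hdiag : ∀ i, 0 ≤ B (b i) (b i)) (x : M) : 0 ≤ B x x := by
  rw [← LinearMap.sum_repr_mul_repr_mulₛₗ b b]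
  refine Finset.sum_nonneg fun i hi => ?_
  beta_reduce
  rw [Finsupp.sum, Finset.sum_eq_single_of_mem i hi fun j _ hj => by
    rw [LinearMap.isOrthoᵢ_def.1 hortho i j hj.symm, smul_zero, smul_zero]]
  rw [RingHom.id_apply, smul_smul, smul_eq_mul, RCLike.conj_mul]
  exact mul_nonneg (mod_cast sq_nonneg ‖b.repr x i‖) (hdiag i)

theorem ofReal_sub_I_ne_zero (b : ℝ) : (b : ℂ) - Complex.I ≠ 0 := fun h => by
  simpa using congrArg Complex.im h

/-- The Cayley transform of `b ∈ ℝ`, that is, the point `e^{iθ}` of the circle, `0 < θ < 2π`, with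
`cot (θ / 2) = b`. -/
def cayley (b : ℝ) : ℂ := (b + Complex.I) / (b - Complex.I)

/-- The weight `2 ε (b (1 - cos θ) - sin θ)` on the circle, `z = e^{iθ}`, which vanishes at `1` and
at `cayley b` only. The sign `ε = ±1` selects the arc on which it is positive. -/
def weight (ε b : ℝ) : C(Circle, ℝ) :=
  ⟨fun z => 2 * ε * (b * (1 - (z : ℂ).re) - (z : ℂ).im), by fun_prop⟩

theorem weight_apply (ε b : ℝ) (z : Circle) :
    weight ε b z = 2 * ε * (b * (1 - (z : ℂ).re) - (z : ℂ).im) := rfl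

theorem weight_eq_conj_mul (ε b : ℝ) (z : Circle) : (weight ε b z : ℂ) =
    ε * (Complex.I - b) * (conj (z : ℂ) * ((z - 1) * (z - cayley b))) := by
  have hζ : cayley b * (b - Complex.I) = b + Complex.I :=
    div_mul_cancel₀ _ (ofReal_sub_I_ne_zero b)
  have hre := Complex.add_conj (z : ℂ)
  have him := Complex.sub_conj (z : ℂ)
  rw [weight_apply]
  push_cast at hre him ⊢
  linear_combination (ε : ℂ) * b * hre - ε * Complex.I * him -
    ε * (Complex.I - b) * (z - cayley b - 1) * mul_conj_coe z - ε * (1 - conj (z : ℂ)) * hζ -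
    2 * ε * ((z : ℂ).im : ℂ) * Complex.I_sq

theorem form_weight (μ : Measure Circle) [IsFiniteMeasure μ] (ε b : ℝ) (q p : ℂ[X]) :
    form μ (weight ε b) q p =
      ε * (Complex.I - b) * form μ 1 (X * q) ((X - C 1) * ((X - C (cayley b)) * p)) := by
  rw [← smul_eq_mul, ← map_smul]
  refine form_congr fun z => ?_
  rw [weight_eq_conj_mul]
  simp only [eval_mul, eval_sub, eval_smul, eval_X, eval_C, map_mul, smul_eq_mul,
    ContinuousMap.one_apply, Complex.ofReal_one]
  ring

variable (μ : Measure Circle) [IsFiniteMeasure μ] (ζ : ℂ)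

/-- The ratios `R_{n+1}(ζ) / R_n(ζ)`. -/
def evalRatio (n : ℕ) : ℂ := (R μ (n + 1)).eval ζ / (R μ n).eval ζ

/-- The polynomials `S_n(z) = (R_{n+1}(z) - t_n R_n(z)) / (z - ζ)`, `t_n = R_{n+1}(ζ) / R_n(ζ)`: the
Christoffel transform at `ζ` of the sequence `R`. The division is exact if `R_n(ζ) ≠ 0`. -/
def christoffel (n : ℕ) : ℂ[X] :=
  (R μ (n + 1) - C (evalRatio μ ζ n) * R μ n) /ₘ (X - C ζ)

variable {μ ζ}

omit [IsFiniteMeasure μ] in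
theorem X_sub_C_mul_christoffel {n : ℕ} (h : (R μ n).eval ζ ≠ 0) :
    (X - C ζ) * christoffel μ ζ n = R μ (n + 1) - C (evalRatio μ ζ n) * R μ n := by
  rw [christoffel, mul_divByMonic_eq_iff_isRoot, IsRoot, eval_sub, eval_mul, eval_C, evalRatio,
    div_mul_cancel₀ _ h, sub_self]

theorem natDegree_christoffel_le (hμ : Nontrivial μ) (n : ℕ) :
    (christoffel μ ζ n).natDegree ≤ n := by
  rw [christoffel, natDegree_divByMonic _ (monic_X_sub_C ζ), natDegree_X_sub_C,
    Nat.sub_le_iff_le_add]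
  exact (natDegree_sub_le _ _).trans <| max_le (natDegree_R_le hμ _) <|
    (natDegree_C_mul_le _ _).trans <| (natDegree_R_le hμ n).trans n.le_succ

theorem coeff_christoffel_self (hμ : Nontrivial μ) {n : ℕ} (h : (R μ n).eval ζ ≠ 0) :
    (christoffel μ ζ n).coeff n = scale μ (n + 1) := by
  have hcoeff := congrArg (coeff · (n + 1)) (X_sub_C_mul_christoffel h)
  simpa [sub_mul, coeff_R_self hμ,
    coeff_eq_zero_of_natDegree_lt (Nat.lt_succ_of_le (natDegree_R_le hμ n)),
    coeff_eq_zero_of_natDegree_lt (Nat.lt_succ_of_le (natDegree_christoffel_le hμ n))]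
    using hcoeff

theorem degree_christoffel (hμ : Nontrivial μ) {n : ℕ} (h : (R μ n).eval ζ ≠ 0) :
    (christoffel μ ζ n).degree = n :=
  degree_eq_of_le_of_coeff_ne_zero (natDegree_le_iff_degree_le.1 (natDegree_christoffel_le hμ n))
    (by rw [coeff_christoffel_self hμ h]; exact scale_ne_zero hμ _)

variable {ε b : ℝ}

theorem form_weight_X_pow_christoffel {n : ℕ} (h : (R μ n).eval (cayley b) ≠ 0) (k : ℕ) :
    form μ (weight ε b) (X ^ k) (christoffel μ (cayley b) n) =
      ε * (Complex.I - b) * (form μ 1 (X ^ (k + 1)) ((X - C 1) * R μ (n + 1)) -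
        evalRatio μ (cayley b) n * form μ 1 (X ^ (k + 1)) ((X - C 1) * R μ n)) := by
  rw [form_weight, X_sub_C_mul_christoffel h, ← pow_succ', ← smul_eq_C_mul, mul_sub (X - C 1),
    mul_smul_comm, map_sub, map_smul, smul_eq_mul]

theorem form_weight_X_pow_christoffel_of_lt (hμ : Nontrivial μ) {k n : ℕ}
    (h : (R μ n).eval (cayley b) ≠ 0) (hk : k < n) :
    form μ (weight ε b) (X ^ k) (christoffel μ (cayley b) n) = 0 := by
  rw [form_weight_X_pow_christoffel h, form_X_pow_succ_X_sub_one_mul_R_of_lt hμ hk,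
    form_X_pow_succ_X_sub_one_mul_R_of_lt hμ (hk.trans n.lt_succ_self), mul_zero, sub_zero,
    mul_zero]

theorem form_weight_christoffel_of_lt (hμ : Nontrivial μ) {m n : ℕ}
    (h : (R μ n).eval (cayley b) ≠ 0) (hm : m < n) :
    form μ (weight ε b) (christoffel μ (cayley b) m) (christoffel μ (cayley b) n) = 0 :=
  apply_eq_zero_of_degree_lt ((form μ (weight ε b)).flip _)
    (fun _ hk => form_weight_X_pow_christoffel_of_lt hμ h hk)
    ((degree_le_of_natDegree_le (natDegree_christoffel_le hμ m)).trans_lt (by exact_mod_cast hm))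

theorem form_weight_christoffel_self (hμ : Nontrivial μ) {n : ℕ}
    (h : (R μ n).eval (cayley b) ≠ 0) :
    form μ (weight ε b) (christoffel μ (cayley b) n) (christoffel μ (cayley b) n) =
      ε * (b - Complex.I) * evalRatio μ (cayley b) n *
        (((‖scale μ (n + 1)‖ ^ 2 * (1 - (modVerblunsky μ n).re) : ℝ) : ℂ) *
          form μ 1 (monicOPUC μ n) (monicOPUC μ n)) := by
  have hlead := apply_eq_coeff_smul_apply_X_pow
    ((form μ (weight ε b)).flip (christoffel μ (cayley b) n))
    (p := christoffel μ (cayley b) n) (n := n) fun k hk => hk.lt_or_gt.symm.imp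
      (fun hk => coeff_eq_zero_of_natDegree_lt ((natDegree_christoffel_le hμ n).trans_lt hk))
      (form_weight_X_pow_christoffel_of_lt hμ h)
  rw [LinearMap.flip_apply, LinearMap.flip_apply, coeff_christoffel_self hμ h,
    form_weight_X_pow_christoffel h, form_X_pow_succ_X_sub_one_mul_R_of_lt hμ n.lt_succ_self,
    form_X_pow_succ_X_sub_one_mul_R_self hμ, smul_eq_mul] at hlead
  rw [hlead]
  push_cast
  rw [← Complex.conj_mul']
  ring

theorem form_weight_self_nonneg (hμ : Nontrivial μ)
    (h : ∀ n, 0 < ε * (b - Complex.I) * evalRatio μ (cayley b) n) (q : ℂ[X]) :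
    0 ≤ form μ (weight ε b) q q := by
  have hR (n : ℕ) : (R μ n).eval (cayley b) ≠ 0 := fun h0 => by
    simpa [evalRatio, h0] using h n
  let S : Polynomial.Sequence ℂ := ⟨christoffel μ (cayley b), fun n => degree_christoffel hμ (hR n)⟩
  let basis := S.basis fun n => isUnit_iff_ne_zero.2 (leadingCoeff_ne_zero.2 (S.ne_zero n))
  have hbasis (n : ℕ) : basis n = christoffel μ (cayley b) n := S.basis_eq_self _ n
  refine apply_self_nonneg_of_basis basis (LinearMap.isOrthoᵢ_def.2 fun m n hmn => ?_)
    (fun n => ?_) q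
  · rw [hbasis, hbasis]
    rcases hmn.lt_or_gt with hmn | hmn
    · exact form_weight_christoffel_of_lt hμ (hR n) hmn
    · exact form_isSymm.isRefl.eq_zero (form_weight_christoffel_of_lt hμ (hR m) hmn)
  · rw [hbasis, form_weight_christoffel_self hμ (hR n)]
    have hre := one_sub_re_modVerblunsky_pos hμ n
    refine mul_nonneg (h n).le (mul_nonneg (Complex.zero_le_real.2 (by positivity)) ?_)
    exact (form_one_self_pos hμ (isMonicOfDegree_monicOPUC μ n).ne_zero).le

end ChristoffelTransform

section Comparison

/-- The solution of the recurrence relation `V_{n+1} = y_{n+1} V_n - e_{n+1} V_{n-1}` with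
`V_{-1} = 0`, `V_0 = 1`. -/
def threeTermSolution {K : Type*} [Ring K] (y e : ℕ → K) : ℕ → K
  | 0 => 1
  | 1 => y 1
  | n + 2 => y (n + 2) * threeTermSolution y e (n + 1) - e (n + 2) * threeTermSolution y e n

theorem threeTermSolution_pos {K : Type*} [CommRing K] [LinearOrder K] [IsStrictOrderedRing K]
    {y e g : ℕ → K} (hy : ∀ n, 1 ≤ n → 0 < y n) (hg : ∀ n, 1 ≤ n → 0 ≤ g n ∧ g n < 1)
    (he : ∀ n, 1 ≤ n → e (n + 1) ≤ (1 - g n) * g (n + 1) * (y n * y (n + 1))) (n : ℕ) :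
    0 < threeTermSolution y e n := by
  suffices H : 0 < threeTermSolution y e n ∧
      (1 - g (n + 1)) * y (n + 1) * threeTermSolution y e n ≤ threeTermSolution y e (n + 1) from H.1
  induction n with
  | zero =>
    simp only [threeTermSolution, zero_add, mul_one, zero_lt_one, true_and]
    nlinarith [hy 1 le_rfl, hg 1 le_rfl]
  | succ n ih =>
    obtain ⟨hV, hle⟩ := ih
    have hV' : 0 < threeTermSolution y e (n + 1) :=
      (mul_pos (mul_pos (sub_pos.2 (hg (n + 1) (by lia)).2) (hy (n + 1) (by lia))) hV).trans_le hle
    refine ⟨hV', ?_⟩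
    have hstep := mul_le_mul_of_nonneg_right (he (n + 1) (by lia)) hV.le
    have hgrow := mul_le_mul_of_nonneg_left hle
      (mul_nonneg (hg (n + 2) (by lia)).1 (hy (n + 2) (by lia)).le)
    rw [threeTermSolution]
    linear_combination hstep + hgrow

/-- The real numbers `V_n` such that `R_n(ζ) = (2 ε / (b - i))^n V_n` for `ζ = cayley b`, where
`ε = ±1` and `c`, `d` are the coefficients of the recurrence relation for `R`. -/
def normalizedEval (c d : ℕ → ℝ) (ε b : ℝ) : ℕ → ℝ :=
  threeTermSolution (fun n => ε * (b - c n)) (fun n => d n * (b ^ 2 + 1))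

theorem normalizedEval_add_two (c d : ℕ → ℝ) (ε b : ℝ) (n : ℕ) :
    normalizedEval c d ε b (n + 2) = ε * (b - c (n + 2)) * normalizedEval c d ε b (n + 1) -
      d (n + 2) * (b ^ 2 + 1) * normalizedEval c d ε b n := rfl

variable {μ : Measure Circle} {c d q : ℕ → ℝ} {ε b : ℝ}

theorem IsRecurrenceCoeffs.eval_cayley (h : IsRecurrenceCoeffs μ c d) (hε : ε ^ 2 = 1) (n : ℕ) :
    (R μ n).eval (cayley b) = (2 * ε / (b - Complex.I)) ^ n * normalizedEval c d ε b n := by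
  have hb := ofReal_sub_I_ne_zero b
  have hε' : (ε : ℂ) ^ 2 = 1 := mod_cast hε
  have hlin (x : ℝ) : (1 + Complex.I * x) * cayley b + (1 - Complex.I * x) =
      2 * ε / (b - Complex.I) * ((ε * (b - x) : ℝ) : ℂ) := by
    rw [cayley]
    push_cast
    field_simp
    linear_combination (2 * (x : ℂ)) * Complex.I_sq + (2 * x - 2 * b : ℂ) * hε'
  have hquad : cayley b * 4 = (2 * ε / (b - Complex.I)) ^ 2 * (b ^ 2 + 1) := by
    rw [cayley]
    field_simp
    linear_combination (-4 : ℂ) * Complex.I_sq - 4 * (b ^ 2 + 1) * hε'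
  induction n using Nat.twoStepInduction with
  | zero => simp [h.1, normalizedEval, threeTermSolution]
  | one =>
    rw [h.2.1, h.1]
    simp only [mul_one, eval_add, eval_mul, eval_C, eval_X, normalizedEval,
      threeTermSolution, hlin, pow_one]
  | more n ih ih' =>
    rw [h.2.2 (n + 1) (by lia), Nat.add_sub_cancel]
    simp only [eval_sub, eval_add, eval_mul, eval_C, eval_X, hlin, ih, ih']
    rw [normalizedEval_add_two]
    push_cast
    linear_combination (-(d (n + 2) : ℂ) * (2 * ε / (b - Complex.I)) ^ n *
      normalizedEval c d ε b n) * hquad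

theorem IsRecurrenceCoeffs.evalRatio_cayley_pos (h : IsRecurrenceCoeffs μ c d)
    (hε : ε ^ 2 = 1) (hV : ∀ n, 0 < normalizedEval c d ε b n) (n : ℕ) :
    0 < ε * (b - Complex.I) * evalRatio μ (cayley b) n := by
  have hb := ofReal_sub_I_ne_zero b
  have hε' : (ε : ℂ) ^ 2 = 1 := mod_cast hε
  have hε0 : (ε : ℂ) ≠ 0 := fun h => by simp [h] at hε'
  have hκ : 2 * (ε : ℂ) / (b - Complex.I) ≠ 0 := div_ne_zero (mul_ne_zero two_ne_zero hε0) hb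
  have hratio : ε * (b - Complex.I) * evalRatio μ (cayley b) n =
      ((2 * (normalizedEval c d ε b (n + 1) / normalizedEval c d ε b n) : ℝ) : ℂ) := by
    rw [evalRatio, h.eval_cayley hε, h.eval_cayley hε, pow_succ, mul_assoc (_ ^ n),
      mul_div_mul_left _ _ (pow_ne_zero n hκ)]
    push_cast
    field_simp
    linear_combination normalizedEval c d ε b (n + 1) / normalizedEval c d ε b n * hε'
  rw [hratio, Complex.zero_lt_real]
  exact mul_pos two_pos (div_pos (hV _) (hV n))

theorem IsScalingSequence.exists_param (hq : IsScalingSequence q d) :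
    ∃ g : ℕ → ℝ, (∀ n, 1 ≤ n → 0 ≤ g n ∧ g n < 1) ∧
      ∀ n, 1 ≤ n → d (n + 1) = q (n + 1) * ((1 - g n) * g (n + 1)) := by
  obtain ⟨hq, g, hg₁, hg, hdq⟩ := hq
  refine ⟨g, fun n hn => ?_, fun n hn => ?_⟩
  · rcases hn.eq_or_lt with rfl | hn
    exacts [hg₁, ⟨(hg n hn).1.le, (hg n hn).2⟩]
  · rw [← hdq n hn, mul_div_cancel₀ _ (hq n hn).1.ne']

theorem IsScalingSequence.normalizedEval_pos (hq : IsScalingSequence q d) (hε : ε ^ 2 = 1)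
    (hc : ∀ n, 1 ≤ n → 0 < ε * (b - c n))
    (hcq : ∀ n, 1 ≤ n → q (n + 1) * (b ^ 2 + 1) ≤ (b - c n) * (b - c (n + 1))) (n : ℕ) :
    0 < normalizedEval c d ε b n := by
  obtain ⟨g, hg, hd⟩ := hq.exists_param
  refine threeTermSolution_pos hc hg (fun n hn => ?_) n
  have hscaled := mul_le_mul_of_nonneg_left (hcq n hn)
    (mul_nonneg (sub_pos.2 (hg n hn).2).le (hg (n + 1) (by lia)).1)
  rw [hd n hn]
  linear_combination hscaled - (1 - g n) * g (n + 1) * (b - c n) * (b - c (n + 1)) * hε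

end Comparison

section Density

theorem ae_nonneg_of_forall_integral_mul_sq_nonneg {X : Type*} [TopologicalSpace X]
    [CompactSpace X] [MeasurableSpace X] [OpensMeasurableSpace X] {ν : Measure X}
    [IsFiniteMeasureOnCompacts ν] {w : C(X, ℝ)} (h : ∀ f : C(X, ℝ), 0 ≤ ∫ x, w x * f x ^ 2 ∂ν) :
    ∀ᵐ x ∂ν, 0 ≤ w x := by
  have hcube (x : X) : w x * (w x)⁻ ^ 2 = -(w x)⁻ ^ 3 := by
    rcases le_total 0 (w x) with hx | hx
    · simp [negPart_eq_zero.2 hx]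
    · rw [negPart_eq_neg.2 hx]
      ring
  have hnonneg (x : X) : 0 ≤ (w x)⁻ ^ 3 := pow_nonneg (negPart_nonneg _) 3
  have hcont : Continuous fun x => (w x)⁻ := by simp only [negPart_def]; fun_prop
  have hint := h ⟨fun x => (w x)⁻, hcont⟩
  simp only [ContinuousMap.coe_mk, hcube, integral_neg] at hint
  have hzero : ∫ x, (w x)⁻ ^ 3 ∂ν = 0 :=
    le_antisymm (neg_nonneg.1 hint) (integral_nonneg hnonneg)
  filter_upwards [(integral_eq_zero_iff_of_nonneg hnonneg
    (integrable_of_continuous ν (hcont.pow 3))).1 hzero] with x hx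
  exact negPart_eq_zero.1 (pow_eq_zero_iff three_ne_zero |>.1 hx)

/-- The Laurent polynomials `z ^ (-N) p(z)`, as continuous functions on the circle. -/
def laurentPolynomials : StarSubalgebra ℂ C(Circle, ℂ) where
  carrier := {f | ∃ (N : ℕ) (p : ℂ[X]), ∀ z : Circle, (z : ℂ) ^ N * f z = p.eval (z : ℂ)}
  mul_mem' := by
    rintro f g ⟨N, p, hp⟩ ⟨M, q, hq⟩
    refine ⟨N + M, p * q, fun z => ?_⟩
    rw [eval_mul, ← hp, ← hq, ContinuousMap.mul_apply]
    ring
  add_mem' := by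
    rintro f g ⟨N, p, hp⟩ ⟨M, q, hq⟩
    refine ⟨N + M, X ^ M * p + X ^ N * q, fun z => ?_⟩
    simp only [eval_add, eval_mul, eval_pow, eval_X, ← hp, ← hq, ContinuousMap.add_apply]
    ring
  algebraMap_mem' a := ⟨0, C a, fun z => by simp⟩
  star_mem' := by
    rintro f ⟨N, p, hp⟩
    refine ⟨p.natDegree, X ^ N * (p.map (starRingEnd ℂ)).reflect p.natDegree, fun z => ?_⟩
    have hpow : (z : ℂ) ^ N * conj (z : ℂ) ^ N = 1 := by rw [← mul_pow, mul_conj_coe, one_pow]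
    rw [eval_mul, eval_pow, eval_X, eval_reflect_map_conj le_rfl, ← hp, map_mul, map_pow,
      ContinuousMap.star_apply, ← starRingEnd_apply]
    linear_combination -((z : ℂ) ^ p.natDegree * conj (f z)) * hpow

theorem laurentPolynomials_topologicalClosure : laurentPolynomials.topologicalClosure = ⊤ :=
  ContinuousMap.starSubalgebra_topologicalClosure_eq_top_of_separatesPoints _ fun _ _ hne =>
    ⟨_, ⟨⟨fun z : Circle => (z : ℂ), by fun_prop⟩,
      ⟨0, X, fun z => by rw [pow_zero, one_mul, eval_X]; rfl⟩, rfl⟩,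
      fun h => hne (Circle.ext h)⟩

theorem continuous_integral_continuousMap {X E : Type*} [TopologicalSpace X] [CompactSpace X]
    [MeasurableSpace X] [BorelSpace X] [NormedAddCommGroup E] [NormedSpace ℝ E]
    [SecondCountableTopologyEither X E] (ν : Measure X) [IsFiniteMeasure ν] :
    Continuous fun f : C(X, E) => ∫ x, f x ∂ν :=
  (continuous_integral.comp (ContinuousMap.toLp 1 ν ℝ).continuous).congr fun f =>
    integral_congr_ae (ContinuousMap.coeFn_toLp ν f)

variable {μ : Measure Circle} [IsFiniteMeasure μ]

theorem ae_nonneg_of_form_self_nonneg {w : C(Circle, ℝ)} (h : ∀ p, 0 ≤ form μ w p p) :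
    ∀ᵐ z ∂μ, 0 ≤ w z := by
  let normSq : C(ℂ, ℝ) := ⟨fun v => ‖v‖ ^ 2, by fun_prop⟩
  have hclosed : IsClosed {f : C(Circle, ℂ) | 0 ≤ ∫ z, w z * ‖f z‖ ^ 2 ∂μ} :=
    isClosed_le continuous_const <| (continuous_integral_continuousMap μ).comp <|
      (continuous_const (y := w)).mul (ContinuousMap.continuous_postcomp normSq)
  have hlaurent :
      (laurentPolynomials : Set C(Circle, ℂ)) ⊆ {f | 0 ≤ ∫ z, w z * ‖f z‖ ^ 2 ∂μ} := by
    rintro f ⟨N, p, hp⟩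
    have hnorm (z : Circle) : ‖f z‖ = ‖p.eval (z : ℂ)‖ := by
      rw [← hp, norm_mul, norm_pow, Circle.norm_coe, one_pow, one_mul]
    simpa only [Set.mem_ofPred_eq, hnorm, form_self, Complex.zero_le_real] using h p
  have hall (f : C(Circle, ℂ)) : 0 ≤ ∫ z, w z * ‖f z‖ ^ 2 ∂μ :=
    closure_minimal hlaurent hclosed <|
      laurentPolynomials_topologicalClosure.ge (StarSubalgebra.mem_top (x := f))
  refine ae_nonneg_of_forall_integral_mul_sq_nonneg fun f => ?_
  let g : C(Circle, ℂ) := ⟨fun z => f z, by fun_prop⟩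
  have hg (z : Circle) : ‖g z‖ ^ 2 = f z ^ 2 := by
    rw [← sq_abs (f z), ← Real.norm_eq_abs, ← Complex.norm_real]; rfl
  simpa only [hg] using hall g

theorem IsRecurrenceCoeffs.ae_weight_nonneg {c d q : ℕ → ℝ} {ε b : ℝ} (hμ : Nontrivial μ)
    (h : IsRecurrenceCoeffs μ c d) (hq : IsScalingSequence q d) (hε : ε ^ 2 = 1)
    (hc : ∀ n, 1 ≤ n → 0 < ε * (b - c n))
    (hcq : ∀ n, 1 ≤ n → q (n + 1) * (b ^ 2 + 1) ≤ (b - c n) * (b - c (n + 1))) :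
    ∀ᵐ z ∂μ, 0 ≤ weight ε b z :=
  ae_nonneg_of_form_self_nonneg <| form_weight_self_nonneg hμ <|
    h.evalRatio_cayley_pos hε (hq.normalizedEval_pos hε hc hcq)

end Density

section Roots

variable {a b q x : ℝ}

theorem uPlus_one_le_iff : uPlus a b 1 ≤ x ↔ a < x ∧ b < x ∧ x ^ 2 + 1 ≤ (x - a) * (x - b) := by
  rcases le_or_gt 0 (a + b) with hab | hab
  · rw [uPlus, if_pos rfl, if_pos hab]
    refine iff_of_false (not_le.2 (EReal.coe_lt_top x)) ?_
    rintro ⟨ha, hb, h⟩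
    have hmid : 0 ≤ x - (a + b) / 2 := by linarith
    nlinarith [mul_nonneg hab hmid, sq_nonneg a, sq_nonneg b]
  · rw [uPlus, if_pos rfl, if_neg hab.not_ge, EReal.coe_le_coe_iff, div_le_iff_of_neg hab]
    refine ⟨fun h => ⟨?_, ?_, by linarith⟩, fun h => by linarith [h.2.2]⟩
    · by_contra! ha
      nlinarith [sq_nonneg a]
    · by_contra! hb
      nlinarith [sq_nonneg b]

theorem uPlus_le_iff (h₀ : 0 < q) (h₁ : q ≤ 1) :
    uPlus a b q ≤ x ↔ a < x ∧ b < x ∧ q * (x ^ 2 + 1) ≤ (x - a) * (x - b) := by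
  rcases h₁.eq_or_lt with rfl | h₁
  · rw [uPlus_one_le_iff, one_mul]
  have hfactor := fun t => quadratic_factor a b q t h₀.le h₁
  have hle : (a + b - √(discr a b q)) / (2 * (1 - q)) ≤
      (a + b + √(discr a b q)) / (2 * (1 - q)) := by
    have := Real.sqrt_nonneg (discr a b q)
    have := sub_pos.2 h₁
    gcongr
    linarith
  rw [uPlus, if_neg h₁.ne, EReal.coe_le_coe_iff]
  generalize (a + b + √(discr a b q)) / (2 * (1 - q)) = u at *
  generalize (a + b - √(discr a b q)) / (2 * (1 - q)) = v at *
  have hbetween (t : ℝ) (ht : (t - a) * (t - b) = 0) : v < t ∧ t < u := by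
    have hneg : (1 - q) * ((t - v) * (t - u)) < 0 := by
      nlinarith [hfactor t, mul_pos h₀ (by positivity : 0 < t ^ 2 + 1)]
    have := (pos_iff_neg_of_mul_neg hneg).1 (sub_pos.2 h₁)
    constructor <;> by_contra! <;> nlinarith
  obtain ⟨hva, hau⟩ := hbetween a (by ring)
  obtain ⟨-, hbu⟩ := hbetween b (by ring)
  refine ⟨fun h => ⟨hau.trans_le h, hbu.trans_le h, ?_⟩, fun ⟨ha, _, h⟩ => ?_⟩
  · have := mul_nonneg (mul_nonneg (sub_pos.2 h₁).le (sub_nonneg.2 (hle.trans h))) (sub_nonneg.2 h)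
    linarith [hfactor x]
  · have hpos : 0 < (1 - q) * (x - v) := mul_pos (sub_pos.2 h₁) (sub_pos.2 (hva.trans ha))
    exact sub_nonneg.1 ((mul_nonneg_iff_of_pos_left hpos).1 (by linarith [hfactor x, h]))

theorem uMinus_eq_neg_uPlus_neg (a b q : ℝ) : uMinus a b q = -uPlus (-a) (-b) q := by
  have hdiscr : discr (-a) (-b) q = discr a b q := by unfold discr; ring
  have hsum : 0 ≤ -a + -b ↔ a + b ≤ 0 := by rw [← neg_add, neg_nonneg]
  rw [uMinus, uPlus, hdiscr]
  simp only [hsum]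
  split_ifs
  · rfl
  · rw [← EReal.coe_neg, ← neg_add, div_neg, neg_neg, neg_mul_neg]
  · rw [← EReal.coe_neg, ← neg_div]
    congr 2
    ring

theorem le_uMinus_iff (h₀ : 0 < q) (h₁ : q ≤ 1) :
    x ≤ uMinus a b q ↔ x < a ∧ x < b ∧ q * (x ^ 2 + 1) ≤ (x - a) * (x - b) := by
  rw [uMinus_eq_neg_uPlus_neg, EReal.le_neg, ← EReal.coe_neg, uPlus_le_iff h₀ h₁, neg_lt_neg_iff,
    neg_lt_neg_iff, neg_sq, ← neg_sub', ← neg_sub', neg_mul_neg]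

theorem uPlus_ne_bot (a b q : ℝ) : uPlus a b q ≠ ⊥ := by
  unfold uPlus
  split_ifs
  exacts [top_ne_bot, EReal.coe_ne_bot _, EReal.coe_ne_bot _]

theorem uMinus_ne_top (a b q : ℝ) : uMinus a b q ≠ ⊤ := by
  rw [uMinus_eq_neg_uPlus_neg, Ne, EReal.neg_eq_top_iff]
  exact uPlus_ne_bot _ _ _

end Roots

section Arcs

theorem arccot_coe (x : ℝ) : arccot x = Real.pi / 2 - Real.arctan x := by
  rw [arccot, if_neg (EReal.coe_ne_top x), if_neg (EReal.coe_ne_bot x), EReal.toReal_coe]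

theorem weight_exp (ε b θ : ℝ) : weight ε b (Circle.exp θ) =
    4 * ε * Real.sin (θ / 2) * (b * Real.sin (θ / 2) - Real.cos (θ / 2)) := by
  rw [weight_apply, Circle.coe_exp, Complex.exp_ofReal_mul_I_re, Complex.exp_ofReal_mul_I_im]
  have hcos := Real.cos_two_mul (θ / 2)
  have hsin := Real.sin_two_mul (θ / 2)
  rw [mul_div_cancel₀ θ two_ne_zero] at hcos hsin
  rw [hcos, hsin]
  linear_combination (-4 * ε * b) * Real.sin_sq_add_cos_sq (θ / 2)

theorem weight_exp_eq_mul_sin_sub (ε b θ : ℝ) : weight ε b (Circle.exp θ) =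
    4 * √(1 + b ^ 2) * Real.sin (θ / 2) * (ε * Real.sin (θ / 2 - arccot b)) := by
  rw [weight_exp, arccot_coe, Real.sin_sub, Real.sin_pi_div_two_sub, Real.cos_pi_div_two_sub,
    Real.sin_arctan, Real.cos_arctan]
  field_simp

theorem weight_exp_neg_iff {ε b θ : ℝ} (h₀ : 0 < θ) (h₁ : θ < 2 * Real.pi) :
    weight ε b (Circle.exp θ) < 0 ↔ ε * Real.sin (θ / 2 - arccot b) < 0 := by
  have hsin : 0 < Real.sin (θ / 2) := Real.sin_pos_of_pos_of_lt_pi (by linarith) (by linarith)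
  rw [weight_exp_eq_mul_sin_sub, ← neg_pos, ← mul_neg, mul_pos_iff_of_pos_left (by positivity),
    neg_pos]

theorem two_mul_arccot_le_of_weight_nonneg {ε b θ : ℝ} (hε : 0 < ε) (h₀ : 0 < θ)
    (h₁ : θ < 2 * Real.pi) (h : 0 ≤ weight ε b (Circle.exp θ)) : 2 * arccot b ≤ θ := by
  by_contra! hθ
  have hlt : arccot b < Real.pi := by
    linarith [arccot_coe b, Real.neg_pi_div_two_lt_arctan b]
  exact h.not_gt <| (weight_exp_neg_iff h₀ h₁).2 <| mul_neg_of_pos_of_neg hε <|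
    Real.sin_neg_of_neg_of_neg_pi_lt (by linarith) (by linarith)

theorem le_two_mul_arccot_of_weight_nonneg {ε b θ : ℝ} (hε : ε < 0) (h₀ : 0 < θ)
    (h₁ : θ < 2 * Real.pi) (h : 0 ≤ weight ε b (Circle.exp θ)) : θ ≤ 2 * arccot b := by
  by_contra! hθ
  have hpos : 0 < arccot b := by
    linarith [arccot_coe b, Real.arctan_lt_pi_div_two b]
  exact h.not_gt <| (weight_exp_neg_iff h₀ h₁).2 <| mul_neg_of_neg_of_pos hε <|
    Real.sin_pos_of_pos_of_lt_pi (by linarith) (by linarith)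

theorem exists_exp_eq_of_ne_one {z : Circle} (hz : z ≠ 1) :
    ∃ θ, 0 < θ ∧ θ < 2 * Real.pi ∧ Circle.exp θ = z := by
  have harg : (z : ℂ).arg ≠ 0 := fun h => hz (Circle.arg_eq_zero.1 h)
  have hlower := Complex.neg_pi_lt_arg (z : ℂ)
  have hupper := Complex.arg_le_pi (z : ℂ)
  rcases harg.lt_or_gt with h | h
  · exact ⟨(z : ℂ).arg + 2 * Real.pi, by linarith, by linarith,
      by rw [Circle.exp_add_two_pi, Circle.exp_arg]⟩
  · exact ⟨(z : ℂ).arg, h, by linarith, Circle.exp_arg z⟩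

theorem isClosed_closedArc (a b : ℝ) : IsClosed (closedArc a b) := by
  have himage : closedArc a b = Circle.exp '' Set.Icc a b := by
    ext z
    simp only [closedArc, Set.mem_ofPred_eq, Set.mem_image, Set.mem_Icc, and_assoc, eq_comm]
  rw [himage]
  exact (isCompact_Icc.image Circle.exp.continuous).isClosed

theorem sub_smul_dirac_apply_singleton {X : Type*} [MeasurableSpace X] [MeasurableSingletonClass X]
    (μ : Measure X) (x : X) : (μ - μ {x} • Measure.dirac x) {x} = 0 := by
  refine Measure.sub_apply_eq_zero_of_restrict_le_restrict ?_ (measurableSet_singleton x)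
  rw [← Measure.restrict_singleton, Measure.restrict_restrict (measurableSet_singleton x),
    Set.inter_self]

variable {μ : Measure Circle} [IsFiniteMeasure μ] {c d q : ℕ → ℝ}

theorem IsRecurrenceCoeffs.ae_two_mul_arccot_le (hμ : Nontrivial μ)
    (h : IsRecurrenceCoeffs μ c d) (hq : IsScalingSequence q d) {s : EReal}
    (hle : ∀ n, 1 ≤ n → uPlus (c n) (c (n + 1)) (q (n + 1)) ≤ s) :
    ∀ᵐ z ∂μ, ∀ θ, 0 < θ → θ < 2 * Real.pi → Circle.exp θ = z → 2 * arccot s ≤ θ := by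
  induction s with
  | bot => exact absurd (le_bot_iff.1 (hle 1 le_rfl)) (uPlus_ne_bot _ _ _)
  | top => exact .of_forall fun _ θ h₀ _ _ => by simpa [arccot] using h₀.le
  | coe b =>
    have hb (n : ℕ) (hn : 1 ≤ n) := (uPlus_le_iff (hq.1 n hn).1 (hq.1 n hn).2).1 (hle n hn)
    filter_upwards [h.ae_weight_nonneg hμ hq (one_pow 2) (b := b)
      (fun n hn => by linarith [(hb n hn).1]) fun n hn => (hb n hn).2.2]
    rintro _ hz θ h₀ h₁ rfl
    exact two_mul_arccot_le_of_weight_nonneg one_pos h₀ h₁ hz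

theorem IsRecurrenceCoeffs.ae_le_two_mul_arccot (hμ : Nontrivial μ)
    (h : IsRecurrenceCoeffs μ c d) (hq : IsScalingSequence q d) {s : EReal}
    (hle : ∀ n, 1 ≤ n → s ≤ uMinus (c n) (c (n + 1)) (q (n + 1))) :
    ∀ᵐ z ∂μ, ∀ θ, 0 < θ → θ < 2 * Real.pi → Circle.exp θ = z → θ ≤ 2 * arccot s := by
  induction s with
  | bot => exact .of_forall fun _ θ _ h₁ _ => by simpa [arccot] using h₁.le
  | top => exact absurd (top_le_iff.1 (hle 1 le_rfl)) (uMinus_ne_top _ _ _)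
  | coe b =>
    have hb (n : ℕ) (hn : 1 ≤ n) := (le_uMinus_iff (hq.1 n hn).1 (hq.1 n hn).2).1 (hle n hn)
    filter_upwards [h.ae_weight_nonneg hμ hq (neg_one_sq (R := ℝ)) (b := b)
      (fun n hn => by linarith [(hb n hn).1]) fun n hn => (hb n hn).2.2]
    rintro _ hz θ h₀ h₁ rfl
    exact le_two_mul_arccot_of_weight_nonneg neg_one_lt_zero h₀ h₁ hz

theorem IsRecurrenceCoeffs.ae_theta₁_le (hμ : Nontrivial μ) (h : IsRecurrenceCoeffs μ c d)
    (hq : IsScalingSequence q d) :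
    ∀ᵐ z ∂μ, ∀ θ, 0 < θ → θ < 2 * Real.pi → Circle.exp θ = z → theta₁ c q ≤ θ :=
  h.ae_two_mul_arccot_le hμ hq <|
    le_iSup₂ (f := fun (n : ℕ) (_ : 1 ≤ n) => uPlus (c n) (c (n + 1)) (q (n + 1)))

theorem IsRecurrenceCoeffs.ae_le_theta₂ (hμ : Nontrivial μ) (h : IsRecurrenceCoeffs μ c d)
    (hq : IsScalingSequence q d) :
    ∀ᵐ z ∂μ, ∀ θ, 0 < θ → θ < 2 * Real.pi → Circle.exp θ = z → θ ≤ theta₂ c q :=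
  h.ae_le_two_mul_arccot hμ hq <|
    iInf₂_le (f := fun (n : ℕ) (_ : 1 ≤ n) => uMinus (c n) (c (n + 1)) (q (n + 1)))

end Arcs

theorem mainTheorem1_general (μ : Measure Circle) [IsFiniteMeasure μ] (hμ : Nontrivial μ) :
    (∃ c d : ℕ → ℝ, IsRecurrenceCoeffs μ c d ∧ IsPositiveChainSequence d) ∧
    ∀ c d q : ℕ → ℝ, IsRecurrenceCoeffs μ c d → IsScalingSequence q d →
      (μ - μ {1} • Measure.dirac 1).support ⊆ closedArc (theta₁ c q) (theta₂ c q) := by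
  refine ⟨⟨_, _, isRecurrenceCoeffs_recCoeff hμ, isPositiveChainSequence_chainParam hμ⟩,
    fun c d q h hq => Measure.support_subset_of_isClosed (isClosed_closedArc _ _) ?_⟩
  have hac : μ - μ {1} • Measure.dirac 1 ≪ μ := Measure.absolutelyContinuous_of_le Measure.sub_le
  have hone : ∀ᵐ z ∂(μ - μ {1} • Measure.dirac 1), z ≠ 1 :=
    measure_eq_zero_iff_ae_notMem.1 (sub_smul_dirac_apply_singleton μ 1)
  filter_upwards [hone, hac.ae_le (h.ae_theta₁_le hμ hq), hac.ae_le (h.ae_le_theta₂ hμ hq)]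
    with z hz h₁ h₂
  obtain ⟨θ, hpos, hlt, hθ⟩ := exists_exp_eq_of_ne_one hz
  exact ⟨θ, h₁ θ hpos hlt hθ, h₂ θ hpos hlt hθ, hθ.symm⟩

end CircleSupport

end

theorem mainTheorem1 (μ : Measure Circle) [IsProbabilityMeasure μ]
    (hμ : CircleSupport.Nontrivial μ) :
    (∃ c d : ℕ → ℝ, CircleSupport.IsRecurrenceCoeffs μ c d ∧
      CircleSupport.IsPositiveChainSequence d) ∧
    ∀ c d q : ℕ → ℝ, CircleSupport.IsRecurrenceCoeffs μ c d →
      CircleSupport.IsScalingSequence q d →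
      CircleSupport.theta₁ c q < CircleSupport.theta₂ c q →
      (μ - μ {1} • Measure.dirac 1).support ⊆
        CircleSupport.closedArc (CircleSupport.theta₁ c q) (CircleSupport.theta₂ c q) :=
  ⟨(CircleSupport.mainTheorem1_general μ hμ).1, fun c d q h hq _ =>
    (CircleSupport.mainTheorem1_general μ hμ).2 c d q h hq⟩
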